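/- Let $A$ be an $n\times n$ matrix with nonnegative real entries and let $k\ge 1$. The following holds both in nonnegative linear algebra ($A^k$ the usual power) and in max algebra, i.e. $\mathbb R_{\ge 0}$ with $a\oplus b=\max(a,b)$ and the usual product ($A^k$ the max-algebraic power). Conventions. The digraph of $A$ has nodes $1,\dots,n$ and an edge $(i,j)$ whenever $a_{ij}\neq 0$. A class $\mu$ of $A$ is a strongly connected component of this digraph, with node set $N_\mu$; $\mu$ accesses $\nu$ if $\mu=\nu$ or if some node of $\mu$ is joined to some node of $\nu$ by a path. The cyclicity of $\mu$ is the gcd of the lengths of the elementary cycles of the digraph of the submatrix $A_{\mu\mu}$, and is $1$ if that digraph has no edges; its cyclic classes are the classes of the relation "there is a path from $i$ to $j$ inside $\mu$ (the path of length $0$ being allowed) whose length is a multiple of the cyclicity". The Perron root $\rho_\mu$ is the largest eigenvalue of $A_{\mu\mu}$ in the algebra considered, where an eigenvalue is a $\rho\ge 0$ with $A_{\mu\mu}x=\rho x$ for some nonzero nonnegative vector $x$. The class $\nu$ is spectral if $\rho_\nu\neq 0$ and, for every class $\mu$ that accesses $\nu$: $\rho_\mu<\rho_\nu$ unless $\mu=\nu$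 (nonnegative linear algebra), resp. $\rho_\mu\le\rho_\nu$ (max algebra). A class of $A^k$ is derived from a class of $A$ if its node set is contained in the node set of the latter. **Theorem.** (i) If a class $\nu$ of $A^k$ is derived from a class $\mu$ of $A$, then $\mu$ is spectral in $A$ if and only if $\nu$ is spectral in $A^k$. Moreover, each spectral class of $A^k$ is derived from a spectral class of $A$. (ii) For each class $\mu$ of $A$ with cyclicity $\sigma$, there are exactly $\gcd(k,\sigma)$ classes of $A^k$ derived from it. If $\sigma\mid k$, then the node sets of the derived classes are exactly the cyclic classes of $\mu$. -/

import Mathlib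

open scoped NNReal

namespace NonnegMatrix

section Graph

variable {ι : Type*}

/-- `IsPath A t p`: the vertices `p 0, p 1, …, p t` form a path of length `t` in the digraph of `A`,
whose edges are the pairs `(i, j)` with `A i j ≠ 0` (the values of `p` beyond `t` are irrelevant;
vertices may be visited repeatedly). -/
def IsPath (A : Matrix ι ι ℝ≥0) (t : ℕ) (p : ℕ → ι) : Prop :=
  ∀ s < t, A (p s) (p (s + 1)) ≠ 0

/-- There is a path of length `t` from `i` to `j` in the digraph of `A`. -/
def HasPath (A : Matrix ι ι ℝ≥0) (t : ℕ) (i j : ι) : Prop :=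
  ∃ p : ℕ → ι, IsPath A t p ∧ p 0 = i ∧ p t = j

/-- Vertex `i` accesses vertex `j` (every vertex accesses itself, by the path of length `0`). -/
def Accesses (A : Matrix ι ι ℝ≥0) (i j : ι) : Prop :=
  ∃ t, HasPath A t i j

/-- There is an elementary cycle of length `t` in the digraph of `A`. -/
def HasElementaryCycle (A : Matrix ι ι ℝ≥0) (t : ℕ) : Prop :=
  0 < t ∧ ∃ p : ℕ → ι, IsPath A t p ∧ p 0 = p t ∧ Set.InjOn p (Set.Iio t)

open scoped Classical in
/-- The cyclicity of a strongly connected digraph: the gcd of the lengths of its elementary cycles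
if it has an edge, and `1` if it is trivial (one vertex and no edges). -/
noncomputable def cyclicity (A : Matrix ι ι ℝ≥0) : ℕ :=
  if ∃ i j, A i j ≠ 0 then Nat.setGcd {t | HasElementaryCycle A t} else 1

/-- `D` is a cyclic class of the strongly connected digraph of `A`: all the vertices that can be
reached from a given vertex by a path whose length is a multiple of the cyclicity. For the trivial
graph, this is its unique vertex. -/
def IsCyclicClass (A : Matrix ι ι ℝ≥0) (D : Finset ι) : Prop :=
  ∃ i, ∀ j, j ∈ D ↔ ∃ t, cyclicity A ∣ t ∧ HasPath A t i j

/-- `C` is (the index set of) a class of `A`, that is, the vertex set of a strongly connected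
component of the digraph of `A`. Classes are represented by their index sets. -/
def IsClass (A : Matrix ι ι ℝ≥0) (C : Finset ι) : Prop :=
  ∃ i, ∀ j, j ∈ C ↔ Accesses A i j ∧ Accesses A j i

/-- The principal submatrix of `A` with rows and columns in `C`. -/
def block (A : Matrix ι ι ℝ≥0) (C : Finset ι) : Matrix C C ℝ≥0 :=
  A.submatrix (fun i => (i : ι)) (fun j => (j : ι))

/-- There is an arc from `C` to `D` in the reduced graph of `A`, whose nodes are the classes. -/
def ReducedArc (A : Matrix ι ι ℝ≥0) (C D : Finset ι) : Prop :=
  IsClass A C ∧ IsClass A D ∧ ∃ i ∈ C, ∃ j ∈ D, 0 < A i j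

/-- Class `C` accesses class `D`: they are equal or there is a path from `C` to `D` in the
reduced graph. -/
def ClassAccesses (A : Matrix ι ι ℝ≥0) (C D : Finset ι) : Prop :=
  Relation.ReflTransGen (ReducedArc A) C D

/-- The cyclicity of the class `C` of `A`. -/
noncomputable def classCyclicity (A : Matrix ι ι ℝ≥0) (C : Finset ι) : ℕ :=
  cyclicity (block A C)

/-- `D` is the index set of a cyclic class of the class `C` of `A`. -/
def IsCyclicClassOf (A : Matrix ι ι ℝ≥0) (C D : Finset ι) : Prop :=
  ∃ E : Finset C, IsCyclicClass (block A C) E ∧ D = E.map (Function.Embedding.subtype (· ∈ C))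

/-- For a power `B` of `A`: `D` is a class of `B` derived from the class `C` of `A`. -/
def IsDerived (A B : Matrix ι ι ℝ≥0) (C D : Finset ι) : Prop :=
  IsClass A C ∧ IsClass B D ∧ D ⊆ C

end Graph

section Spectral

variable {ι : Type*} [Fintype ι]

/-- The max-algebraic product of matrices, `(A ⊗ B) i j = max_l A i l * B l j`. -/
def maxMul (A B : Matrix ι ι ℝ≥0) : Matrix ι ι ℝ≥0 :=
  Matrix.of fun i j => Finset.univ.sup fun l => A i l * B l j

/-- The max-algebraic power `A^{⊗ k}` (the max-algebraic unit matrix is the usual one). -/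
def maxPow [DecidableEq ι] (A : Matrix ι ι ℝ≥0) : ℕ → Matrix ι ι ℝ≥0
  | 0 => 1
  | k + 1 => maxMul (maxPow A k) A

/-- The max-algebraic matrix-vector product, `(A ⊗ x) i = max_j A i j * x j`. -/
def maxMulVec (A : Matrix ι ι ℝ≥0) (x : ι → ℝ≥0) : ι → ℝ≥0 :=
  fun i => Finset.univ.sup fun j => A i j * x j

/-- `r` is an eigenvalue of `A` in nonnegative linear algebra: it has a nonnegative eigenvector. -/
def IsEigenvalue (A : Matrix ι ι ℝ≥0) (r : ℝ≥0) : Prop :=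
  ∃ x : ι → ℝ≥0, x ≠ 0 ∧ A.mulVec x = r • x

/-- `r` is an eigenvalue of `A` in max algebra. -/
def IsMaxEigenvalue (A : Matrix ι ι ℝ≥0) (r : ℝ≥0) : Prop :=
  ∃ x : ι → ℝ≥0, x ≠ 0 ∧ maxMulVec A x = r • x

/-- The principal eigenvalue of `A` in nonnegative linear algebra: the greatest eigenvalue (the set
of eigenvalues is finite, and nonempty for a nonempty index set). -/
noncomputable def perronRoot (A : Matrix ι ι ℝ≥0) : ℝ≥0 := sSup {r | IsEigenvalue A r}

/-- The principal eigenvalue of `A` in max algebra: the greatest max-algebraic eigenvalue (the set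
of these is finite, and nonempty for a nonempty index set). -/
noncomputable def maxPerronRoot (A : Matrix ι ι ℝ≥0) : ℝ≥0 := sSup {r | IsMaxEigenvalue A r}

/-- The Perron root of the class `C` of `A` in nonnegative linear algebra. -/
noncomputable def classRoot {ι : Type*} (A : Matrix ι ι ℝ≥0) (C : Finset ι) : ℝ≥0 :=
  perronRoot (block A C)

/-- The Perron root of the class `C` of `A` in max algebra. -/
noncomputable def classMaxRoot {ι : Type*} (A : Matrix ι ι ℝ≥0) (C : Finset ι) : ℝ≥0 :=
  maxPerronRoot (block A C)

/-- `C` is a spectral class of `A` in nonnegative linear algebra. -/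
def IsSpectral {ι : Type*} (A : Matrix ι ι ℝ≥0) (C : Finset ι) : Prop :=
  IsClass A C ∧ classRoot A C ≠ 0 ∧
    ∀ D, IsClass A D → ClassAccesses A D C → D ≠ C → classRoot A D < classRoot A C

/-- `C` is a spectral class of `A` in max algebra. -/
def IsMaxSpectral {ι : Type*} (A : Matrix ι ι ℝ≥0) (C : Finset ι) : Prop :=
  IsClass A C ∧ classMaxRoot A C ≠ 0 ∧
    ∀ D, IsClass A D → ClassAccesses A D C → classMaxRoot A D ≤ classMaxRoot A C

end Spectral

end NonnegMatrix

/-! Sums of nonnegative terms do not cancel, in either algebra, so the `(i, j)` entry of the `k`-th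
power is nonzero exactly when `A` has a walk of length `k` from `i` to `j`. The graph arguments use
only this property, as the hypothesis `hB` on a matrix `B`, and so serve both algebras.

Counting: inside a class of cyclicity `σ`, walks with the same ends have lengths congruent mod `σ`,
and conversely a walk whose length is divisible by `gcd k σ` can be lengthened by cycles to a
multiple of `k` (`exists_hasPath_of_gcd_dvd`). The derived classes are thus labelled by walk length
mod `gcd k σ` from a base vertex.

Spectrality: `r` is an eigenvalue of a class iff `r ^ k` is one of each class derived from it
(`exists_eigenvector_derived_iff`). One direction restricts an eigenvector, the other extends one by
zero and takes a geometric sum of its iterates. Only semiring operations occur, so the max-times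
semiring is covered too. Hence roots are raised to the power `k`. Access between classes lifts to
derived classes by adjusting lengths inside a class with an edge (`exists_isDerived_classAccesses`);
classes without edges have root zero and never obstruct spectrality. -/

namespace NonnegMatrix

/-! ### Walks, closed walks and cyclicity. -/

section Walks

variable {ι : Type*} {A B : Matrix ι ι ℝ≥0} {i j l : ι} {s t k : ℕ}

lemma hasPath_zero : HasPath A 0 i j ↔ i = j := by
  constructor
  · rintro ⟨p, -, rfl, rfl⟩; rfl
  · rintro rfl; exact ⟨fun _ => i, fun s hs => absurd hs (by omega), rfl, rfl⟩

lemma HasPath.trans (h₁ : HasPath A s i j) (h₂ : HasPath A t j l) : HasPath A (s + t) i l := by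
  obtain ⟨p, hp, rfl, hps⟩ := h₁
  obtain ⟨q, hq, hq0, rfl⟩ := h₂
  refine ⟨fun u => if u ≤ s then p u else q (u - s), fun u hu => ?_, by simp, ?_⟩
  · rcases lt_trichotomy u s with h | rfl | h
    · have := hp u h
      simp only [h.le, if_true, Nat.succ_le_of_lt h]
      exact this
    · have := hq 0 (by omega)
      simp only [le_refl, if_true, Nat.not_succ_le_self, if_false, hps, ← hq0]
      simpa using this
    · have := hq (u - s) (by omega)
      simp only [not_le.2 h, if_false, show ¬ u + 1 ≤ s by omega]
      rwa [show u + 1 - s = u - s + 1 by omega]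
  · rcases Nat.eq_zero_or_pos t with rfl | h
    · simp [hps, hq0]
    · simp [show ¬ s + t ≤ s by omega]

lemma IsPath.hasPath {p : ℕ → ι} (hp : IsPath A t p) {a b : ℕ} (hab : a ≤ b) (hb : b ≤ t) :
    HasPath A (b - a) (p a) (p b) := by
  refine ⟨fun u => p (a + u), fun u hu => hp (a + u) (by omega), by simp, ?_⟩
  simp [Nat.add_sub_cancel' hab]

lemma hasPath_one : HasPath A 1 i j ↔ A i j ≠ 0 := by
  constructor
  · rintro ⟨p, hp, rfl, rfl⟩; exact hp 0 one_pos
  · intro h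
    refine ⟨fun u => if u = 0 then i else j, fun u hu => ?_, by simp, by simp⟩
    obtain rfl : u = 0 := by omega
    simpa using h

lemma hasPath_add : HasPath A (s + t) i j ↔ ∃ l, HasPath A s i l ∧ HasPath A t l j := by
  constructor
  · rintro ⟨p, hp, rfl, rfl⟩
    exact ⟨p s, by simpa using hp.hasPath (Nat.zero_le s) (by omega),
      by simpa using hp.hasPath (Nat.le_add_right s t) le_rfl⟩
  · rintro ⟨l, h₁, h₂⟩; exact h₁.trans h₂

lemma hasPath_succ : HasPath A (t + 1) i j ↔ ∃ l, HasPath A t i l ∧ A l j ≠ 0 := by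
  simp_rw [hasPath_add, hasPath_one]

lemma hasPath_succ' : HasPath A (t + 1) i j ↔ ∃ l, A i l ≠ 0 ∧ HasPath A t l j := by
  simp_rw [add_comm t 1, hasPath_add, hasPath_one]

lemma HasPath.iterate (h : HasPath A t i i) (m : ℕ) : HasPath A (m * t) i i := by
  induction m with
  | zero => simpa using hasPath_zero.2 rfl
  | succ m ih => rw [Nat.succ_mul]; exact ih.trans h

lemma HasPath.accesses (h : HasPath A t i j) : Accesses A i j := ⟨t, h⟩

lemma Accesses.refl (A : Matrix ι ι ℝ≥0) (i : ι) : Accesses A i i := ⟨0, hasPath_zero.2 rfl⟩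

lemma Accesses.trans (h₁ : Accesses A i j) (h₂ : Accesses A j l) : Accesses A i l := by
  obtain ⟨s, hs⟩ := h₁
  obtain ⟨t, ht⟩ := h₂
  exact ⟨s + t, hs.trans ht⟩

/-- The length of a closed walk is divisible by the gcd of the lengths of elementary cycles. -/
lemma HasPath.setGcd_dvd (h : HasPath A t i i) :
    Nat.setGcd {t | HasElementaryCycle A t} ∣ t := by
  induction t using Nat.strong_induction_on generalizing i with
  | _ t ih =>
    rcases Nat.eq_zero_or_pos t with rfl | ht
    · exact dvd_zero _
    obtain ⟨p, hp, hp0, hpt⟩ := h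
    by_cases hinj : Set.InjOn p (Set.Iio t)
    · exact Nat.setGcd_dvd_of_mem ⟨ht, p, hp, hp0.trans hpt.symm, hinj⟩
    -- A repeated vertex cuts the closed walk into two shorter closed walks.
    obtain ⟨a, b, hab, hbt, hpab⟩ : ∃ a b, a < b ∧ b < t ∧ p a = p b := by
      simp only [Set.InjOn, Set.mem_Iio, not_forall] at hinj
      obtain ⟨a, ha, b, hb, hpab, hne⟩ := hinj
      rcases lt_or_gt_of_ne hne with h | h
      · exact ⟨a, b, h, hb, hpab⟩
      · exact ⟨b, a, h, ha, hpab.symm⟩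
    have h₁ := hp.hasPath (Nat.zero_le a) (by omega)
    have h₂ := hp.hasPath hab.le hbt.le
    have h₃ := hp.hasPath hbt.le le_rfl
    rw [hpt, ← hpab] at h₃
    rw [hp0] at h₁
    rw [← hpab] at h₂
    have := dvd_add (ih _ (by omega) (h₁.trans h₃)) (ih _ (by omega) h₂)
    rwa [show a - 0 + (t - b) + (b - a) = t by omega] at this

lemma HasPath.cyclicity_dvd (h : HasPath A t i i) : cyclicity A ∣ t := by
  unfold cyclicity
  split_ifs
  · exact h.setGcd_dvd
  · exact one_dvd t

/-- The same return walk closes both walks, and the cyclicity divides the length of every closed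
walk. -/
lemma hasPath_modEq_cyclicity (hA : ∀ i j, Accesses A i j) (hs : HasPath A s i j)
    (ht : HasPath A t i j) : s ≡ t [MOD cyclicity A] := by
  obtain ⟨u, hu⟩ := hA j i
  have h₁ := (hs.trans hu).cyclicity_dvd
  have h₂ := (ht.trans hu).cyclicity_dvd
  exact Nat.ModEq.add_right_cancel' u
    ((Nat.modEq_zero_iff_dvd.2 h₁).trans (Nat.modEq_zero_iff_dvd.2 h₂).symm)

/-- Modulo `k`, every sum of lengths of elementary cycles of a strongly connected digraph is the
length of a closed walk through a given vertex. -/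
lemma exists_closed_walk_modEq (hA : ∀ i j, Accesses A i j) (hk : 1 ≤ k) (i : ι) {m : ℕ}
    (hm : m ∈ AddSubmonoid.closure {t | HasElementaryCycle A t}) :
    ∃ c, HasPath A c i i ∧ c ≡ m [MOD k] := by
  induction hm using AddSubmonoid.closure_induction with
  | mem c hc =>
    obtain ⟨-, p, hp, hp0, -⟩ := hc
    obtain ⟨a, ha⟩ := hA i (p 0)
    obtain ⟨b, hb⟩ := hA (p 0) i
    have hc : HasPath A c (p 0) (p 0) := ⟨p, hp, rfl, hp0.symm⟩
    -- The detour of length `a + b` to the cycle and back is made `k` times in all, so only `c`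
    -- remains mod `k`.
    refine ⟨_, ((ha.trans hc).trans hb).trans ((ha.trans hb).iterate (k - 1)), ?_⟩
    obtain ⟨k, rfl⟩ := Nat.exists_eq_add_of_le' hk
    have : a + c + b + (k + 1 - 1) * (a + b) = c + (k + 1) * (a + b) := by
      rw [Nat.add_sub_cancel]; ring
    rw [this]
    simp [Nat.ModEq]
  | zero => exact ⟨0, hasPath_zero.2 rfl, rfl⟩
  | add x y _ _ hx hy =>
    obtain ⟨a, ha, hax⟩ := hx
    obtain ⟨b, hb, hby⟩ := hy
    exact ⟨a + b, ha.trans hb, hax.add hby⟩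

/-- All large multiples of the cyclicity are sums of elementary cycle lengths, and Bézout selects
one that completes `t` to a multiple of `k`. It is realised mod `k` by a closed walk at `i`,
prepended to the given walk. -/
lemma exists_hasPath_of_gcd_dvd (hA : ∀ i j, Accesses A i j) (hk : 1 ≤ k)
    (ht : HasPath A t i j) (hd : Nat.gcd k (cyclicity A) ∣ t) :
    ∃ s, k ∣ s ∧ HasPath A s i j := by
  by_cases he : ∃ i j, A i j ≠ 0
  · have hcyc : cyclicity A = Nat.setGcd {t | HasElementaryCycle A t} := if_pos he
    obtain ⟨N, hN⟩ := Nat.exists_mem_closure_of_ge {t | HasElementaryCycle A t}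
    rw [← hcyc] at hN
    set σ := cyclicity A with hσ
    rcases Nat.eq_zero_or_pos σ with h0 | hpos
    · exact ⟨t, by simpa [h0] using hd, ht⟩
    obtain ⟨m, hm, hmN, hmt⟩ : ∃ m, σ ∣ m ∧ N ≤ m ∧ k ∣ m + t := by
      obtain ⟨u, hu⟩ := hd
      have hk' : (k : ℤ) ≠ 0 := by exact_mod_cast (by omega : k ≠ 0)
      -- With `t = gcd * u`, Bézout makes `σ * (-(gcdB * u)) + t` divisible by `k`. Reduction mod
      -- `k` makes the factor nonnegative; adding `k * N` below makes it large.
      set y : ℤ := (-(Nat.gcdB k σ * u)) % k with hy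
      have hy0 : 0 ≤ y := Int.emod_nonneg _ hk'
      refine ⟨σ * (y.toNat + k * N), dvd_mul_right _ _, ?_, ?_⟩
      · nlinarith [Nat.zero_le y.toNat, Nat.mul_le_mul hpos (Nat.mul_le_mul hk (le_refl N)),
          Nat.zero_le (σ * y.toNat)]
      · rw [← Int.natCast_dvd_natCast, hu]
        push_cast
        rw [Int.toNat_of_nonneg hy0, Nat.gcd_eq_gcd_ab k σ, hy, Int.emod_def]
        refine ⟨-(σ * ((-(Nat.gcdB k σ * u)) / k)) + σ * N + Nat.gcdA k σ * u, ?_⟩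
        ring
    obtain ⟨c, hc, hcm⟩ := exists_closed_walk_modEq hA hk i (hN m hmN hm)
    refine ⟨c + t, ?_, hc.trans ht⟩
    exact (Nat.modEq_zero_iff_dvd.1 ((hcm.add_right t).trans (Nat.modEq_zero_iff_dvd.2 hmt)))
  · rcases t with _ | t
    · exact ⟨0, dvd_zero k, ht⟩
    · obtain ⟨l, -, hl⟩ := hasPath_succ.1 ht
      exact absurd ⟨l, j, hl⟩ he

lemma exists_hasPath_of_edge (hA : ∀ i j, Accesses A i j) (he : ∃ i j, A i j ≠ 0) (i : ι) (t : ℕ) :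
    ∃ j, HasPath A t i j := by
  have hout : ∀ i, ∃ j, A i j ≠ 0 := by
    intro i
    obtain ⟨a, b, hab⟩ := he
    obtain ⟨u, hu⟩ := hA i a
    obtain ⟨l, hl, -⟩ := hasPath_succ'.1 (hasPath_succ.2 ⟨a, hu, hab⟩)
    exact ⟨l, hl⟩
  induction t with
  | zero => exact ⟨i, hasPath_zero.2 rfl⟩
  | succ t ih =>
    obtain ⟨j, hj⟩ := ih
    obtain ⟨l, hl⟩ := hout j
    exact ⟨l, hasPath_succ.2 ⟨j, hj, hl⟩⟩

/-- Without edges the cyclicity is `1`, which leaves only `t = 0`. -/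
lemma exists_hasPath_of_lt_gcd (hA : ∀ i j, Accesses A i j) (i : ι)
    (ht : t < Nat.gcd k (cyclicity A)) : ∃ j, HasPath A t i j := by
  by_cases he : ∃ i j, A i j ≠ 0
  · exact exists_hasPath_of_edge hA he i t
  · have : cyclicity A = 1 := if_neg he
    rw [this, Nat.gcd_one_right, Nat.lt_one_iff] at ht
    exact ⟨i, ht ▸ hasPath_zero.2 rfl⟩

/-- A walk of length divisible by `k` in a strongly connected digraph can be reversed. -/
lemma exists_hasPath_symm (hk : 1 ≤ k) (h : HasPath A (k * s) i j) (h' : Accesses A j i) :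
    ∃ t, HasPath A (k * t) j i := by
  obtain ⟨t, ht⟩ := h'
  obtain ⟨k, rfl⟩ := Nat.exists_eq_add_of_le' hk
  refine ⟨t + k * s, ?_⟩
  -- Here `k` is one less than the original exponent: the return walk of length `t` is used `k + 1`
  -- times.
  have := ht.trans ((h.trans ht).iterate k)
  rwa [show t + k * ((k + 1) * s + t) = (k + 1) * (t + k * s) by ring] at this

end Walks

/-! ### Classes, access between them, and their blocks. -/

section Classes

variable {ι : Type*} {A B : Matrix ι ι ℝ≥0} {i j l : ι} {s t k : ℕ} {C D : Finset ι}

lemma IsClass.nonempty (hC : IsClass A C) : C.Nonempty := by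
  obtain ⟨i, hi⟩ := hC
  exact ⟨i, (hi i).2 ⟨.refl A i, .refl A i⟩⟩

lemma IsClass.mem_iff (hC : IsClass A C) (hi : i ∈ C) :
    j ∈ C ↔ Accesses A i j ∧ Accesses A j i := by
  obtain ⟨c, hc⟩ := hC
  obtain ⟨h₁, h₂⟩ := (hc i).1 hi
  rw [hc]
  exact ⟨fun ⟨h₃, h₄⟩ => ⟨h₂.trans h₃, h₄.trans h₁⟩, fun ⟨h₃, h₄⟩ => ⟨h₁.trans h₃, h₄.trans h₂⟩⟩

lemma IsClass.accesses (hC : IsClass A C) (hi : i ∈ C) (hj : j ∈ C) : Accesses A i j :=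
  ((hC.mem_iff hi).1 hj).1

lemma IsClass.mem_of_accesses (hC : IsClass A C) (hi : i ∈ C) (hj : j ∈ C)
    (h₁ : Accesses A i l) (h₂ : Accesses A l j) : l ∈ C :=
  (hC.mem_iff hi).2 ⟨h₁, h₂.trans (hC.accesses hj hi)⟩

lemma IsClass.eq_of_mem (hC : IsClass A C) (hD : IsClass A D) (hi : i ∈ C) (hj : i ∈ D) :
    C = D := by
  ext l
  rw [hC.mem_iff hi, hD.mem_iff hj]

lemma exists_isClass [Fintype ι] (A : Matrix ι ι ℝ≥0) (i : ι) : ∃ C, IsClass A C ∧ i ∈ C := by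
  classical
  exact ⟨Finset.univ.filter fun j => Accesses A i j ∧ Accesses A j i, ⟨i, by simp⟩,
    by simp [Accesses.refl]⟩

lemma ClassAccesses.exists_accesses (hC : IsClass A C) (h : ClassAccesses A C D) :
    ∃ i ∈ C, ∃ j ∈ D, Accesses A i j := by
  induction h with
  | refl =>
    obtain ⟨i, hi⟩ := hC.nonempty
    exact ⟨i, hi, i, hi, .refl A i⟩
  | tail _ h ih =>
    obtain ⟨i, hi, j, hj, hij⟩ := ih
    obtain ⟨hD, -, a, ha, b, hb, hab⟩ := h
    exact ⟨i, hi, b, hb, (hij.trans (hD.accesses hj ha)).trans ⟨1, hasPath_one.2 hab.ne'⟩⟩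

lemma Accesses.classAccesses [Fintype ι] (hC : IsClass A C) (hD : IsClass A D) (hi : i ∈ C)
    (hj : j ∈ D) (h : Accesses A i j) : ClassAccesses A C D := by
  obtain ⟨t, ht⟩ := h
  induction t generalizing j D with
  | zero =>
    obtain rfl := hasPath_zero.1 ht
    rw [hC.eq_of_mem hD hi hj]
    exact Relation.ReflTransGen.refl
  | succ t ih =>
    obtain ⟨l, hl, hlj⟩ := hasPath_succ.1 ht
    obtain ⟨E, hE, hlE⟩ := exists_isClass A l
    exact (ih hE hlE hl).tail ⟨hE, hD, l, hlE, j, hj, pos_iff_ne_zero.2 hlj⟩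

/-- A walk between two vertices of a class cannot leave the class. -/
lemma hasPath_block (hC : IsClass A C) (i j : C) :
    HasPath (block A C) t i j ↔ HasPath A t i j := by
  induction t generalizing j with
  | zero => rw [hasPath_zero, hasPath_zero, Subtype.ext_iff]
  | succ t ih =>
    simp_rw [hasPath_succ]
    constructor
    · rintro ⟨l, hl, hlj⟩
      exact ⟨l, (ih l).1 hl, hlj⟩
    · rintro ⟨l, hl, hlj⟩
      have hlC := hC.mem_of_accesses i.2 j.2 hl.accesses (hasPath_one.2 hlj).accesses
      exact ⟨⟨l, hlC⟩, (ih ⟨l, hlC⟩).2 hl, hlj⟩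

lemma block_accesses (hC : IsClass A C) (i j : C) : Accesses (block A C) i j := by
  obtain ⟨t, ht⟩ := hC.accesses i.2 j.2
  exact ⟨t, (hasPath_block hC i j).2 ht⟩

end Classes

/-! ### Classes of a power: derivation, counting, access and spectrality. -/

section PowerClasses

variable {ι : Type*} {A B : Matrix ι ι ℝ≥0} {i j l : ι} {s t k : ℕ} {C C' D D' : Finset ι}

lemma hasPath_power (hB : ∀ i j, B i j ≠ 0 ↔ HasPath A k i j) :
    HasPath B t i j ↔ HasPath A (k * t) i j := by
  induction t generalizing j with
  | zero => simp [hasPath_zero]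
  | succ t ih => simp_rw [hasPath_succ, ih, hB, Nat.mul_succ, hasPath_add]

lemma accesses_power (hB : ∀ i j, B i j ≠ 0 ↔ HasPath A k i j) :
    Accesses B i j ↔ ∃ t, HasPath A (k * t) i j := by
  simp_rw [Accesses, hasPath_power hB]

lemma accesses_of_power (hB : ∀ i j, B i j ≠ 0 ↔ HasPath A k i j) (h : Accesses B i j) :
    Accesses A i j := by
  obtain ⟨t, ht⟩ := (accesses_power hB).1 h
  exact ht.accesses

lemma exists_isDerived [Fintype ι] (hB : ∀ i j, B i j ≠ 0 ↔ HasPath A k i j)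
    (hD : IsClass B D) : ∃ C, IsDerived A B C D := by
  obtain ⟨i, hi⟩ := hD.nonempty
  obtain ⟨C, hC, hiC⟩ := exists_isClass A i
  refine ⟨C, hC, hD, fun j hj => (hC.mem_iff hiC).2 ?_⟩
  exact ⟨accesses_of_power hB (hD.accesses hi hj), accesses_of_power hB (hD.accesses hj hi)⟩

lemma isDerived_of_mem (hB : ∀ i j, B i j ≠ 0 ↔ HasPath A k i j) (hC : IsClass A C)
    (hD : IsClass B D) (hi : i ∈ C) (hiD : i ∈ D) : IsDerived A B C D :=
  ⟨hC, hD, fun _ hj => (hC.mem_iff hi).2 ⟨accesses_of_power hB (hD.accesses hiD hj),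
    accesses_of_power hB (hD.accesses hj hiD)⟩⟩

/-- Inside a class of `A`, the classes of the power are closed under access in both directions. -/
lemma IsDerived.mem_of_accesses (hk : 1 ≤ k) (hB : ∀ i j, B i j ≠ 0 ↔ HasPath A k i j)
    (h : IsDerived A B C D) (hi : i ∈ D) (hj : j ∈ C)
    (hij : Accesses B i j ∨ Accesses B j i) : j ∈ D := by
  obtain ⟨hC, hD, hDC⟩ := h
  have key : ∀ a ∈ C, ∀ b ∈ C, Accesses B a b → Accesses B b a := by
    intro a ha b hb hab
    obtain ⟨s, hs⟩ := (accesses_power hB).1 hab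
    exact (accesses_power hB).2 (exists_hasPath_symm hk hs (hC.accesses hb ha))
  rcases hij with hij | hji
  · exact (hD.mem_iff hi).2 ⟨hij, key _ (hDC hi) _ hj hij⟩
  · exact (hD.mem_iff hi).2 ⟨key _ hj _ (hDC hi) hji, hji⟩

lemma IsDerived.mem_iff (hk : 1 ≤ k) (hB : ∀ i j, B i j ≠ 0 ↔ HasPath A k i j)
    (h : IsDerived A B C D) (hi : i ∈ D) :
    j ∈ D ↔ j ∈ C ∧ ∃ s, HasPath A (k * s) i j := by
  rw [← accesses_power hB]
  exact ⟨fun hj => ⟨h.2.2 hj, h.2.1.accesses hi hj⟩,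
    fun ⟨hj, hij⟩ => h.mem_of_accesses hk hB hi hj (.inl hij)⟩

theorem ncard_isDerived [Fintype ι] (hk : 1 ≤ k) (hB : ∀ i j, B i j ≠ 0 ↔ HasPath A k i j)
    (hC : IsClass A C) : {D | IsDerived A B C D}.ncard = Nat.gcd k (classCyclicity A C) := by
  obtain ⟨c, hc⟩ := hC.nonempty
  have hM := block_accesses hC
  set g := Nat.gcd k (classCyclicity A C) with hg
  have hgpos : 0 < g := Nat.gcd_pos_of_pos_left _ hk
  have hmod : ∀ {a b : C} {s t : ℕ}, HasPath A s a b → HasPath A t a b → s ≡ t [MOD g] :=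
    fun {a b s t} hs ht => (hasPath_modEq_cyclicity hM ((hasPath_block hC a b).2 hs)
      ((hasPath_block hC a b).2 ht)).of_dvd (Nat.gcd_dvd_right _ _)
  -- `v t` is the end of a walk of length `t` from the base vertex; its value for `t ≥ g` is
  -- irrelevant.
  have hv : ∀ t, ∃ v : C, t < g → HasPath A t c v := by
    intro t
    by_cases ht : t < g
    · obtain ⟨v, hv⟩ := exists_hasPath_of_lt_gcd hM ⟨c, hc⟩ ht
      exact ⟨v, fun _ => (hasPath_block hC _ _).1 hv⟩
    · exact ⟨⟨c, hc⟩, fun h => absurd h ht⟩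
  choose v hv using hv
  choose E hE hvE using fun t => exists_isClass B (v t : ι)
  have hder : ∀ t, IsDerived A B C (E t) := fun t =>
    isDerived_of_mem hB hC (hE t) (v t).2 (hvE t)
  have himage : {D | IsDerived A B C D} = E '' (Finset.range g : Finset ℕ) := by
    ext D
    constructor
    · intro hD
      obtain ⟨j, hj⟩ := hD.2.1.nonempty
      have hjC := hD.2.2 hj
      obtain ⟨u, hu⟩ := hC.accesses hc hjC
      have hlt := Nat.mod_lt u hgpos
      refine ⟨u % g, by simpa using hlt, ?_⟩
      obtain ⟨w, hw⟩ := hC.accesses (v (u % g)).2 hjC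
      have h₁ : u % g + w ≡ u [MOD g] :=
        hmod (a := ⟨c, hc⟩) (b := ⟨j, hjC⟩) ((hv _ hlt).trans hw) hu
      -- A walk from `v (u % g)` to `j` has length divisible by `g`, hence can be replaced by one of
      -- length divisible by `k`.
      have h₂ : g ∣ w := by
        refine Nat.modEq_zero_iff_dvd.1 (Nat.ModEq.add_left_cancel' (u % g) ?_)
        exact h₁.trans (Nat.mod_modEq u g).symm
      obtain ⟨_, ⟨s, rfl⟩, hs⟩ := exists_hasPath_of_gcd_dvd hM hk
        ((hasPath_block hC (v (u % g)) ⟨j, hjC⟩).2 hw) h₂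
      have hjE : j ∈ E (u % g) := ((hder _).mem_iff hk hB (hvE _)).2
        ⟨hjC, s, (hasPath_block hC _ _).1 hs⟩
      exact (hE _).eq_of_mem hD.2.1 hjE hj
    · rintro ⟨t, -, rfl⟩
      exact hder t
  have hinj : Set.InjOn E (Finset.range g : Finset ℕ) := by
    intro t ht t' ht' hEt
    simp only [Finset.coe_range, Set.mem_Iio] at ht ht'
    have hmem : (v t' : ι) ∈ E t := hEt ▸ hvE t'
    obtain ⟨-, s, hs⟩ := ((hder t).mem_iff hk hB (hvE t)).1 hmem
    -- Vertices of one derived class are joined by a walk whose length is a multiple of `k`, hence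
    -- of `g`, so the labels agree mod `g`.
    have h₁ : t + k * s ≡ t' [MOD g] := hmod (a := ⟨c, hc⟩) ((hv t ht).trans hs) (hv t' ht')
    have h₂ : k * s ≡ 0 [MOD g] :=
      Nat.modEq_zero_iff_dvd.2 (dvd_mul_of_dvd_left (Nat.gcd_dvd_left _ _) s)
    have h₃ : t ≡ t' [MOD g] := (h₂.symm.add_left t).trans h₁
    exact Nat.ModEq.eq_of_lt_of_lt h₃ ht ht'
  rw [himage, hinj.ncard_image, Set.ncard_coe_finset, Finset.card_range]

theorem isDerived_iff_isCyclicClassOf [Fintype ι] (hk : 1 ≤ k)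
    (hB : ∀ i j, B i j ≠ 0 ↔ HasPath A k i j) (hC : IsClass A C) (hσ : classCyclicity A C ∣ k) :
    IsDerived A B C D ↔ IsCyclicClassOf A C D := by
  have hM := block_accesses hC
  have key : ∀ i j : C, (∃ t, cyclicity (block A C) ∣ t ∧ HasPath (block A C) t i j) ↔
      ∃ s, HasPath A (k * s) i j := by
    intro i j
    constructor
    · rintro ⟨t, hd, ht⟩
      obtain ⟨_, ⟨s, rfl⟩, hs⟩ := exists_hasPath_of_gcd_dvd hM hk ht
        ((Nat.gcd_dvd_right _ _).trans hd)
      exact ⟨s, (hasPath_block hC _ _).1 hs⟩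
    · rintro ⟨s, hs⟩
      exact ⟨k * s, dvd_mul_of_dvd_left hσ s, (hasPath_block hC _ _).2 hs⟩
  have hcyc : ∀ {i : C} {D : Finset ι}, IsDerived A B C D → (i : ι) ∈ D → ∀ {E : Finset C},
      (∀ j, j ∈ E ↔ ∃ t, cyclicity (block A C) ∣ t ∧ HasPath (block A C) t i j) →
      D = E.map (Function.Embedding.subtype (· ∈ C)) := by
    intro i D hD hi E hE
    ext j
    simp only [Finset.mem_map, Function.Embedding.subtype_apply, hE, key, hD.mem_iff hk hB hi]
    constructor
    · rintro ⟨hj, h⟩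
      exact ⟨⟨j, hj⟩, h, rfl⟩
    · rintro ⟨j, h, rfl⟩
      exact ⟨j.2, h⟩
  constructor
  · intro hD
    obtain ⟨i, hi⟩ := hD.2.1.nonempty
    classical
    have hE : ∀ j, j ∈ Finset.univ.filter (fun j : C => ∃ t, cyclicity (block A C) ∣ t ∧
        HasPath (block A C) t ⟨i, hD.2.2 hi⟩ j) ↔ ∃ t, cyclicity (block A C) ∣ t ∧
        HasPath (block A C) t ⟨i, hD.2.2 hi⟩ j := by simp
    exact ⟨_, ⟨_, hE⟩, hcyc hD hi hE⟩
  · rintro ⟨E, ⟨i, hE⟩, rfl⟩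
    obtain ⟨D, hD, hi⟩ := exists_isClass B (i : ι)
    have hder := isDerived_of_mem hB hC hD i.2 hi
    rwa [← hcyc hder hi hE]

/-- If a class with an edge accesses a class of `A`, then one of the classes of the power derived
from it accesses any given class of the power derived from the latter. -/
lemma exists_isDerived_classAccesses [Fintype ι] (hk : 1 ≤ k)
    (hB : ∀ i j, B i j ≠ 0 ↔ HasPath A k i j) (hD : IsDerived A B C D) (hC' : IsClass A C')
    (he : ∃ i ∈ C', ∃ j ∈ C', A i j ≠ 0) (h : ClassAccesses A C' C) :
    ∃ D', IsDerived A B C' D' ∧ ClassAccesses B D' D := by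
  obtain ⟨i, hi, j, hj, s, hs⟩ := h.exists_accesses hC'
  obtain ⟨d, hd⟩ := hD.2.1.nonempty
  obtain ⟨u, hu⟩ := hD.1.accesses hj (hD.2.2 hd)
  obtain ⟨a, ha, b, hb, hab⟩ := he
  obtain ⟨x, hx⟩ := hC'.accesses hi ha
  obtain ⟨y, hy⟩ := hC'.accesses hb hi
  have hloop := (hasPath_succ.2 ⟨a, hx, hab⟩).trans hy
  -- The loop has positive length, so enough turns contain a final stretch of length `(k - 1) * (s +
  -- u)`. Started at its first vertex `e`, the walk to `d` has length `k * (s + u)`.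
  have hlong := hloop.iterate ((k - 1) * (s + u))
  rw [show (k - 1) * (s + u) * (x + 1 + y) =
    (k - 1) * (s + u) * (x + y) + (k - 1) * (s + u) by ring] at hlong
  obtain ⟨e, hie, hei⟩ := hasPath_add.1 hlong
  have heC := hC'.mem_of_accesses hi hi hie.accesses hei.accesses
  obtain ⟨D', hD', heD'⟩ := exists_isClass B e
  refine ⟨D', isDerived_of_mem hB hC' hD' heC heD', ?_⟩
  refine Accesses.classAccesses hD' hD.2.1 heD' hd ((accesses_power hB).2 ⟨s + u, ?_⟩)
  have := hei.trans (hs.trans hu)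
  rwa [← Nat.succ_mul, Nat.succ_eq_add_one, Nat.sub_add_cancel hk] at this

/-- Spectrality is inherited by and from derived classes, for any notion of root of a class that
turns powers of matrices into powers and vanishes on classes without edges. -/
theorem spectral_iff_of_root_pow [Fintype ι] {root rootB : Finset ι → ℝ≥0} (hk : 1 ≤ k)
    (hB : ∀ i j, B i j ≠ 0 ↔ HasPath A k i j)
    (hroot : ∀ C D, IsDerived A B C D → rootB D = root C ^ k)
    (hedge : ∀ C, IsClass A C → root C ≠ 0 → ∃ i ∈ C, ∃ j ∈ C, A i j ≠ 0)
    (h : IsDerived A B C D) :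
    (root C ≠ 0 ∧ ∀ C', IsClass A C' → ClassAccesses A C' C → C' ≠ C → root C' < root C) ↔
      (rootB D ≠ 0 ∧ ∀ D', IsClass B D' → ClassAccesses B D' D → D' ≠ D → rootB D' < rootB D) := by
  have hk0 : k ≠ 0 := by omega
  rw [hroot C D h, pow_ne_zero_iff hk0]
  refine and_congr_right fun h0 => ⟨fun hs D' hD' hacc hne => ?_, fun hs C' hC' hacc hne => ?_⟩
  · obtain ⟨C', hder⟩ := exists_isDerived hB hD'
    rw [hroot C' D' hder]
    obtain ⟨i, hi, j, hj, hij⟩ := hacc.exists_accesses hD'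
    refine pow_lt_pow_left₀ (hs C' hder.1 ?_ ?_) zero_le hk0
    · exact Accesses.classAccesses hder.1 h.1 (hder.2.2 hi) (h.2.2 hj) (accesses_of_power hB hij)
    -- Two derived classes of the same class coincide as soon as one accesses the other.
    · rintro rfl
      exact hne (hD'.eq_of_mem h.2.1 hi (h.mem_of_accesses hk hB hj (hder.2.2 hi) (.inr hij)))
  · by_contra hlt
    have hle := not_lt.1 hlt
    -- A violating class has nonzero root, hence an edge, so the violation lifts to the power.
    have h0' : root C' ≠ 0 := fun h => h0 (le_zero_iff.1 (h ▸ hle))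
    obtain ⟨D', hder, hacc'⟩ :=
      exists_isDerived_classAccesses hk hB h hC' (hedge C' hC' h0') hacc
    have := hs D' hder.2.1 hacc' ?_
    · rw [hroot C' D' hder] at this
      exact absurd (pow_le_pow_left₀ zero_le hle k) (not_le.2 this)
    · rintro rfl
      obtain ⟨d, hd⟩ := h.2.1.nonempty
      exact hne (hC'.eq_of_mem h.1 (hder.2.2 hd) (h.2.2 hd))

/-- The variant of `spectral_iff_of_root_pow` with non-strict inequalities. -/
theorem spectral_iff_of_root_pow_le [Fintype ι] {root rootB : Finset ι → ℝ≥0} (hk : 1 ≤ k)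
    (hB : ∀ i j, B i j ≠ 0 ↔ HasPath A k i j)
    (hroot : ∀ C D, IsDerived A B C D → rootB D = root C ^ k)
    (hedge : ∀ C, IsClass A C → root C ≠ 0 → ∃ i ∈ C, ∃ j ∈ C, A i j ≠ 0)
    (h : IsDerived A B C D) :
    (root C ≠ 0 ∧ ∀ C', IsClass A C' → ClassAccesses A C' C → root C' ≤ root C) ↔
      (rootB D ≠ 0 ∧ ∀ D', IsClass B D' → ClassAccesses B D' D → rootB D' ≤ rootB D) := by
  have hk0 : k ≠ 0 := by omega
  rw [hroot C D h, pow_ne_zero_iff hk0]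
  refine and_congr_right fun h0 => ⟨fun hs D' hD' hacc => ?_, fun hs C' hC' hacc => ?_⟩
  · obtain ⟨C', hder⟩ := exists_isDerived hB hD'
    rw [hroot C' D' hder]
    obtain ⟨i, hi, j, hj, hij⟩ := hacc.exists_accesses hD'
    refine pow_le_pow_left₀ zero_le (hs C' hder.1 ?_) k
    exact Accesses.classAccesses hder.1 h.1 (hder.2.2 hi) (h.2.2 hj) (accesses_of_power hB hij)
  · by_cases h0' : root C' = 0
    · rw [h0']; exact zero_le
    obtain ⟨D', hder, hacc'⟩ :=
      exists_isDerived_classAccesses hk hB h hC' (hedge C' hC' h0') hacc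
    have := hs D' hder.2.1 hacc'
    rw [hroot C' D' hder] at this
    exact (pow_le_pow_iff_left₀ zero_le zero_le hk0).1 this

end PowerClasses

lemma pow_mulVec_of_mulVec_eq {κ R : Type*} [Fintype κ] [DecidableEq κ] [CommSemiring R]
    {N : Matrix κ κ R} {x : κ → R} {r : R} (h : N.mulVec x = r • x) (t : ℕ) :
    (N ^ t).mulVec x = r ^ t • x := by
  induction t with
  | zero => simp
  | succ t ih => rw [pow_succ, ← Matrix.mulVec_mulVec, h, Matrix.mulVec_smul, ih, smul_smul,
      pow_succ, mul_comm]

/-! ### Matrices over a semiring where a sum vanishes only if all its terms do. -/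

section Semiring

variable {ι R : Type*} [Fintype ι] [CommSemiring R] [PartialOrder R] [CanonicallyOrderedAdd R]
  [NoZeroDivisors R]

lemma matrix_mul_ne_zero_iff (M N : Matrix ι ι R) (i j : ι) :
    (M * N) i j ≠ 0 ↔ ∃ l, M i l ≠ 0 ∧ N l j ≠ 0 := by
  rw [Matrix.mul_apply, Ne, Finset.sum_eq_zero_iff]
  simp [not_or]

lemma matrix_pow_ne_zero_iff [DecidableEq ι] [Nontrivial R] {A : Matrix ι ι ℝ≥0} {M : Matrix ι ι R}
    (hM : ∀ i j, M i j ≠ 0 ↔ A i j ≠ 0) (t : ℕ) (i j : ι) :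
    (M ^ t) i j ≠ 0 ↔ HasPath A t i j := by
  induction t generalizing j with
  | zero =>
    rw [pow_zero, hasPath_zero, Matrix.one_apply]
    split_ifs with h <;> simp [h]
  | succ t ih => simp_rw [pow_succ, matrix_mul_ne_zero_iff, hasPath_succ, ih, hM]

variable {κ : Type*} [Fintype κ] [DecidableEq κ]

/-- If `x i = 0`, every term of row `i` of `(N ^ t).mulVec x = r ^ t • x` vanishes, in particular
the one for `j` with `x j ≠ 0`. -/
lemma eigenvector_ne_zero {N : Matrix κ κ R} {x : κ → R} {r : R} (hx : x ≠ 0)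
    (h : N.mulVec x = r • x) (hN : ∀ i j, ∃ t, (N ^ t) i j ≠ 0) (i : κ) : x i ≠ 0 := by
  obtain ⟨j, hj⟩ := Function.ne_iff.1 hx
  obtain ⟨t, ht⟩ := hN i j
  have := congrFun (pow_mulVec_of_mulVec_eq h t) i
  intro h0
  rw [Pi.smul_apply, h0, smul_zero, Matrix.mulVec, dotProduct, Finset.sum_eq_zero_iff] at this
  exact mul_ne_zero ht hj (this j (Finset.mem_univ j))

/-- For `r = 0` the last nonzero iterate of `z` is in the kernel of `N`. Otherwise the geometric sum
of the terms `r ^ (k - 1 - t) • (N ^ t).mulVec z` is an eigenvector; it is nonzero because its term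
for `t = 0` is and nothing cancels. -/
lemma exists_eigenvector_of_pow {N : Matrix κ κ R} {z : κ → R} {r : R} {k : ℕ} (hk : 1 ≤ k)
    (hz : z ≠ 0) (h : (N ^ k).mulVec z = r ^ k • z) :
    ∃ x, x ≠ 0 ∧ N.mulVec x = r • x := by
  by_cases hr : r = 0
  · have hex : ∃ t, (N ^ t).mulVec z = 0 :=
      ⟨k, by rw [h, hr, zero_pow (by omega), zero_smul]⟩
    classical
    obtain ⟨t, ht⟩ : ∃ t, Nat.find hex = t + 1 := by
      refine Nat.exists_eq_succ_of_ne_zero fun h0 => hz ?_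
      simpa [h0] using Nat.find_spec hex
    refine ⟨(N ^ t).mulVec z, Nat.find_min hex (by omega), ?_⟩
    rw [hr, zero_smul, Matrix.mulVec_mulVec, ← pow_succ', ← ht]
    exact Nat.find_spec hex
  · obtain ⟨m, rfl⟩ := Nat.exists_eq_add_of_le' hk
    refine ⟨∑ t ∈ Finset.range (m + 1), r ^ (m - t) • (N ^ t).mulVec z, ?_, ?_⟩
    · obtain ⟨i, hi⟩ := Function.ne_iff.1 hz
      refine Function.ne_iff.2 ⟨i, fun h0 => ?_⟩
      rw [Finset.sum_apply, Pi.zero_apply, Finset.sum_eq_zero_iff] at h0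
      have := h0 0 (by simp)
      simp only [tsub_zero, pow_zero, Matrix.one_mulVec, Pi.smul_apply, smul_eq_mul] at this
      exact mul_ne_zero (pow_ne_zero m hr) hi this
    · have h₁ : N.mulVec (∑ t ∈ Finset.range (m + 1), r ^ (m - t) • (N ^ t).mulVec z) =
          ∑ t ∈ Finset.range (m + 1), r ^ (m - t) • (N ^ (t + 1)).mulVec z := by
        rw [Matrix.mulVec_sum]
        refine Finset.sum_congr rfl fun t _ => ?_
        rw [Matrix.mulVec_smul, Matrix.mulVec_mulVec, ← pow_succ']
      -- The top term `(N ^ k).mulVec z` becomes `r ^ k • z`, which is `r` times the term for `t =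
      -- 0`; the other terms match after a shift.
      rw [h₁, Finset.sum_range_succ, Finset.sum_range_succ', smul_add, Finset.smul_sum, h]
      congr 1
      · refine Finset.sum_congr rfl fun t ht => ?_
        have := Finset.mem_range.1 ht
        rw [smul_smul, ← pow_succ', show m - (t + 1) + 1 = m - t by omega]
      · rw [pow_zero, Matrix.one_mulVec, smul_smul, Nat.sub_self, pow_zero, one_mul, tsub_zero,
          smul_smul, ← pow_succ']

end Semiring

/-! ### Eigenvalues of the blocks of derived classes. -/

section Block

variable {ι R : Type*} [Fintype ι] [DecidableEq ι] [CommSemiring R] [PartialOrder R]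
  [CanonicallyOrderedAdd R] [NoZeroDivisors R] [Nontrivial R] {A B : Matrix ι ι ℝ≥0}
  {M : Matrix ι ι R} {C D : Finset ι} {k : ℕ}

/-- Walks between vertices of `C` stay in `C`, so the terms outside `C` vanish. -/
lemma submatrix_pow (hM : ∀ i j, M i j ≠ 0 ↔ A i j ≠ 0) (hC : IsClass A C) (t : ℕ) (i j : C) :
    (M.submatrix ((↑) : C → ι) (↑) ^ t) i j = (M ^ t) i j := by
  induction t generalizing j with
  | zero => simp [Matrix.one_apply]
  | succ t ih =>
    rw [pow_succ, pow_succ, Matrix.mul_apply, Matrix.mul_apply]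
    simp_rw [ih, Matrix.submatrix_apply]
    rw [Finset.sum_coe_sort C fun l => (M ^ t) i l * M l j]
    refine Finset.sum_subset (Finset.subset_univ C) fun l _ hl => ?_
    by_contra h0
    refine hl (hC.mem_of_accesses i.2 j.2 ((matrix_pow_ne_zero_iff hM t _ _).1
      (left_ne_zero_of_mul h0)).accesses (hasPath_one.2 ((hM _ _).1 ?_)).accesses)
    exact right_ne_zero_of_mul h0

/-- The eigenvalues of the block of a derived class of the `k`-th power are the `k`-th powers of
the eigenvalues of the block of the class from which it is derived. -/
theorem exists_eigenvector_derived_iff (hk : 1 ≤ k) (hM : ∀ i j, M i j ≠ 0 ↔ A i j ≠ 0)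
    (hB : ∀ i j, B i j ≠ 0 ↔ HasPath A k i j) (h : IsDerived A B C D) (r : R) :
    (∃ x : C → R, x ≠ 0 ∧ (M.submatrix ((↑) : C → ι) (↑)).mulVec x = r • x) ↔
      ∃ y : D → R, y ≠ 0 ∧ ((M ^ k).submatrix ((↑) : D → ι) (↑)).mulVec y = r ^ k • y := by
  have hC := h.1
  have hDC := h.2.2
  have hB' : ∀ i j, (M ^ k) i j ≠ 0 → Accesses B i j := fun i j hij =>
    ⟨1, hasPath_one.2 ((hB i j).2 ((matrix_pow_ne_zero_iff hM k i j).1 hij))⟩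
  -- the sum over `C` reduces to a sum over `D`
  have hsum : ∀ (w : C → R) (i : C), (∀ j : C, (j : ι) ∉ D → (M ^ k) i j * w j = 0) →
      (M.submatrix ((↑) : C → ι) (↑) ^ k).mulVec w i =
        ∑ j : D, (M ^ k) i j * w ⟨j, hDC j.2⟩ := by
    intro w i hw
    simp_rw [Matrix.mulVec, dotProduct, submatrix_pow hM hC]
    symm
    refine Finset.sum_of_injOn (fun j : D => (⟨j, hDC j.2⟩ : C)) ?_ (by simp) ?_ (by simp)
    · intro a _ b _ hab
      exact Subtype.ext (congrArg (fun c : C => (c : ι)) hab)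
    · intro j _ hj
      refine hw j fun hjD => hj ⟨⟨j, hjD⟩, by simp⟩
  constructor
  · rintro ⟨x, hx, hxr⟩
    -- Strong connectedness makes every coordinate nonzero, so the restriction to `D` is a nonzero
    -- vector.
    have hpos : ∀ i, x i ≠ 0 := by
      refine eigenvector_ne_zero hx hxr fun i j => ?_
      obtain ⟨t, ht⟩ := hC.accesses i.2 j.2
      exact ⟨t, by rw [submatrix_pow hM hC]; exact (matrix_pow_ne_zero_iff hM t _ _).2 ht⟩
    refine ⟨fun i => x ⟨i, hDC i.2⟩, ?_, ?_⟩
    · obtain ⟨d, hd⟩ := h.2.1.nonempty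
      exact Function.ne_iff.2 ⟨⟨d, hd⟩, hpos _⟩
    · ext i
      have := congrFun (pow_mulVec_of_mulVec_eq hxr k) ⟨i, hDC i.2⟩
      rw [hsum x ⟨i, hDC i.2⟩] at this
      · exact this
      · intro j hj
        by_contra h0
        exact hj (h.mem_of_accesses hk hB i.2 j.2 (.inl (hB' _ _ (left_ne_zero_of_mul h0))))
  · rintro ⟨y, hy, hyr⟩
    -- The extension of `y` by zero is an eigenvector on all of `C`, since no walk of length `k`
    -- leads from `C` outside `D` into `D`.
    refine exists_eigenvector_of_pow hk
      (z := fun i : C => if hi : (i : ι) ∈ D then y ⟨i, hi⟩ else 0) ?_ ?_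
    · obtain ⟨d, hd⟩ := Function.ne_iff.1 hy
      refine Function.ne_iff.2 ⟨⟨d, hDC d.2⟩, ?_⟩
      simpa using hd
    · ext i
      rw [hsum _ i (fun j hj => by simp [hj])]
      by_cases hi : (i : ι) ∈ D
      · have := congrFun hyr ⟨i, hi⟩
        simpa [hi, Matrix.mulVec, dotProduct] using this
      · simp only [Pi.smul_apply, hi, dif_neg, not_false_eq_true, smul_zero]
        refine Finset.sum_eq_zero fun j _ => ?_
        by_contra h0
        exact hi (h.mem_of_accesses hk hB j.2 i.2 (.inr (hB' _ _ (left_ne_zero_of_mul h0))))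

end Block

/-- `r ↦ r ^ k` is an order automorphism of `ℝ≥0` carrying `S` onto `T`. Neither boundedness nor
nonemptiness is needed, so no finiteness of the set of eigenvalues enters. -/
lemma sSup_eq_pow_of_forall_iff {k : ℕ} (hk : 1 ≤ k) {S T : Set ℝ≥0}
    (h : ∀ r, r ∈ S ↔ r ^ k ∈ T) : sSup T = sSup S ^ k := by
  let e := NNReal.powOrderIso k (by omega)
  have hT : T = e '' S := by
    ext r
    constructor
    · intro hr
      refine ⟨e.symm r, (h _).2 ?_, e.apply_symm_apply r⟩
      have : e.symm r ^ k = r := e.apply_symm_apply r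
      rwa [this]
    · rintro ⟨s, hs, rfl⟩
      exact (h s).1 hs
  rw [hT, sSup_image', sSup_eq_iSup']
  exact (e.map_ciSup' fun x : S => (x : ℝ≥0)).symm

lemma exists_ne_zero_mem_of_sSup_ne_zero {S : Set ℝ≥0} (h : sSup S ≠ 0) : ∃ r ∈ S, r ≠ 0 := by
  by_contra! h0
  exact h (le_antisymm (csSup_le' fun r hr => (h0 r hr).le) zero_le)

/-! ### Max algebra as a semiring, on a wrapper of `ℝ≥0` with maximum as addition. -/

section MaxTimes

/-- The max-times semiring on `ℝ≥0`. -/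
@[ext]
structure MaxTimes where
  /-- The underlying number. -/
  val : ℝ≥0

namespace MaxTimes

lemma val_injective : Function.Injective val := fun _ _ => MaxTimes.ext

noncomputable instance : LinearOrder MaxTimes := LinearOrder.lift' val val_injective

noncomputable instance : Zero MaxTimes := ⟨⟨0⟩⟩

noncomputable instance : One MaxTimes := ⟨⟨1⟩⟩

noncomputable instance : Add MaxTimes := ⟨fun a b => ⟨max a.val b.val⟩⟩

noncomputable instance : Mul MaxTimes := ⟨fun a b => ⟨a.val * b.val⟩⟩

noncomputable instance : CommSemiring MaxTimes where
  nsmul := nsmulRec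
  npow := npowRec
  add_assoc a b c := MaxTimes.ext (max_assoc _ _ _)
  zero_add a := MaxTimes.ext (max_eq_right zero_le)
  add_zero a := MaxTimes.ext (max_eq_left zero_le)
  add_comm a b := MaxTimes.ext (max_comm _ _)
  mul_assoc a b c := MaxTimes.ext (mul_assoc _ _ _)
  one_mul a := MaxTimes.ext (one_mul _)
  mul_one a := MaxTimes.ext (mul_one _)
  zero_mul a := MaxTimes.ext (zero_mul _)
  mul_zero a := MaxTimes.ext (mul_zero _)
  mul_comm a b := MaxTimes.ext (mul_comm _ _)
  left_distrib a b c := MaxTimes.ext (mul_max _ _ _)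
  right_distrib a b c := MaxTimes.ext (max_mul _ _ _)

lemma val_add (a b : MaxTimes) : (a + b).val = max a.val b.val := rfl
lemma val_zero : (0 : MaxTimes).val = 0 := rfl
lemma val_mul (a b : MaxTimes) : (a * b).val = a.val * b.val := rfl

lemma ne_zero_iff {a : MaxTimes} : a ≠ 0 ↔ a.val ≠ 0 := by
  rw [Ne, MaxTimes.ext_iff, val_zero]

instance : Nontrivial MaxTimes := ⟨0, 1, fun h => zero_ne_one (congrArg val h)⟩

instance : NoZeroDivisors MaxTimes where
  eq_zero_or_eq_zero_of_mul_eq_zero {a b} h := by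
    simpa [MaxTimes.ext_iff, val_mul, val_zero] using h

instance : CanonicallyOrderedAdd MaxTimes where
  le_self_add a b := le_max_left a.val b.val
  le_add_self a b := le_max_right b.val a.val
  exists_add_of_le {a b} h := ⟨b, MaxTimes.ext (max_eq_right (show a.val ≤ b.val from h)).symm⟩

lemma val_sum {κ : Type*} (s : Finset κ) (f : κ → MaxTimes) :
    (∑ i ∈ s, f i).val = s.sup fun i => (f i).val := by
  classical
  induction s using Finset.induction_on with
  | empty => rfl
  | insert a s ha ih => rw [Finset.sum_insert ha, Finset.sup_insert, val_add, ih]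

lemma mk_pow (r : ℝ≥0) (k : ℕ) : (⟨r⟩ : MaxTimes) ^ k = ⟨r ^ k⟩ := by
  induction k with
  | zero => rw [pow_zero, pow_zero]; rfl
  | succ k ih => rw [pow_succ, pow_succ, ih]; rfl

end MaxTimes

variable {ι : Type*} [Fintype ι]

lemma maxMul_map (A B : Matrix ι ι ℝ≥0) :
    (maxMul A B).map MaxTimes.mk = A.map MaxTimes.mk * B.map MaxTimes.mk := by
  ext i j
  simp [maxMul, Matrix.mul_apply, MaxTimes.val_sum, MaxTimes.val_mul]

lemma maxPow_map [DecidableEq ι] (A : Matrix ι ι ℝ≥0) (k : ℕ) :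
    (maxPow A k).map MaxTimes.mk = A.map MaxTimes.mk ^ k := by
  induction k with
  | zero => exact Matrix.map_one _ rfl rfl
  | succ k ih => rw [maxPow, maxMul_map, ih, pow_succ]

lemma isMaxEigenvalue_iff (A : Matrix ι ι ℝ≥0) (r : ℝ≥0) :
    IsMaxEigenvalue A r ↔ ∃ x : ι → MaxTimes, x ≠ 0 ∧
      (A.map MaxTimes.mk).mulVec x = (⟨r⟩ : MaxTimes) • x := by
  have key : ∀ x : ι → MaxTimes, (A.map MaxTimes.mk).mulVec x = (⟨r⟩ : MaxTimes) • x ↔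
      maxMulVec A (fun i => (x i).val) = r • fun i => (x i).val := by
    intro x
    simp [funext_iff, MaxTimes.ext_iff, Matrix.mulVec, dotProduct, MaxTimes.val_sum,
      MaxTimes.val_mul, maxMulVec]
  constructor
  · rintro ⟨x, hx, h⟩
    refine ⟨fun i => ⟨x i⟩, fun h0 => hx ?_, (key _).2 h⟩
    ext i
    exact congrArg (fun a : MaxTimes => (a.val : ℝ)) (congrFun h0 i)
  · rintro ⟨x, hx, h⟩
    refine ⟨fun i => (x i).val, fun h0 => hx ?_, (key x).1 h⟩
    ext i
    exact congrArg ((↑) : ℝ≥0 → ℝ) (congrFun h0 i)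

end MaxTimes

/-! ### Classes with nonzero root have an edge. -/

section Edges

variable {ι : Type*} {A : Matrix ι ι ℝ≥0} {C : Finset ι}

lemma exists_edge_of_classRoot_ne_zero (h : classRoot A C ≠ 0) :
    ∃ i ∈ C, ∃ j ∈ C, A i j ≠ 0 := by
  obtain ⟨r, ⟨x, hx, hxr⟩, hr⟩ := exists_ne_zero_mem_of_sSup_ne_zero h
  obtain ⟨i, hi⟩ := Function.ne_iff.1 hx
  by_contra! h0
  have := congrFun hxr i
  rw [Matrix.mulVec, dotProduct, Finset.sum_eq_zero fun j _ => by
    rw [block, Matrix.submatrix_apply, h0 i i.2 j j.2, zero_mul]] at this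
  exact mul_ne_zero hr hi this.symm

lemma exists_edge_of_classMaxRoot_ne_zero (h : classMaxRoot A C ≠ 0) :
    ∃ i ∈ C, ∃ j ∈ C, A i j ≠ 0 := by
  obtain ⟨r, ⟨x, hx, hxr⟩, hr⟩ := exists_ne_zero_mem_of_sSup_ne_zero h
  obtain ⟨i, hi⟩ := Function.ne_iff.1 hx
  by_contra! h0
  have := congrFun hxr i
  have h1 : maxMulVec (block A C) x i = 0 := by
    refine le_antisymm (Finset.sup_le fun j _ => ?_) zero_le
    rw [block, Matrix.submatrix_apply, h0 i i.2 j j.2, zero_mul]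
  exact mul_ne_zero hr hi (this.symm.trans h1)

end Edges

/-! ### Roots and spectral classes of powers in both algebras. -/

section Roots

variable {ι : Type*} [Fintype ι] [DecidableEq ι] {A : Matrix ι ι ℝ≥0} {C D : Finset ι} {k : ℕ}

lemma pow_ne_zero_iff_hasPath (A : Matrix ι ι ℝ≥0) (k : ℕ) (i j : ι) :
    (A ^ k) i j ≠ 0 ↔ HasPath A k i j :=
  matrix_pow_ne_zero_iff (fun _ _ => Iff.rfl) k i j

lemma maxPow_ne_zero_iff_hasPath (A : Matrix ι ι ℝ≥0) (k : ℕ) (i j : ι) :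
    maxPow A k i j ≠ 0 ↔ HasPath A k i j := by
  rw [← matrix_pow_ne_zero_iff (A := A) (M := A.map MaxTimes.mk)
    (fun _ _ => MaxTimes.ne_zero_iff), ← maxPow_map]
  exact MaxTimes.ne_zero_iff.symm

theorem classRoot_pow (hk : 1 ≤ k) (h : IsDerived A (A ^ k) C D) :
    classRoot (A ^ k) D = classRoot A C ^ k :=
  sSup_eq_pow_of_forall_iff hk fun r =>
    exists_eigenvector_derived_iff hk (fun _ _ => Iff.rfl) (pow_ne_zero_iff_hasPath A k) h r

theorem classMaxRoot_pow (hk : 1 ≤ k) (h : IsDerived A (maxPow A k) C D) :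
    classMaxRoot (maxPow A k) D = classMaxRoot A C ^ k := by
  refine sSup_eq_pow_of_forall_iff hk fun r => ?_
  have := exists_eigenvector_derived_iff (M := A.map MaxTimes.mk) hk
    (fun _ _ => MaxTimes.ne_zero_iff)
    (maxPow_ne_zero_iff_hasPath A k) h ⟨r⟩
  rw [MaxTimes.mk_pow, ← maxPow_map] at this
  exact (isMaxEigenvalue_iff _ _).trans (this.trans (isMaxEigenvalue_iff _ _).symm)

theorem isSpectral_iff (hk : 1 ≤ k) (h : IsDerived A (A ^ k) C D) :
    IsSpectral A C ↔ IsSpectral (A ^ k) D :=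
  and_congr (iff_of_true h.1 h.2.1) (spectral_iff_of_root_pow hk (pow_ne_zero_iff_hasPath A k)
    (fun _ _ => classRoot_pow hk) (fun _ _ => exists_edge_of_classRoot_ne_zero) h)

theorem isMaxSpectral_iff (hk : 1 ≤ k) (h : IsDerived A (maxPow A k) C D) :
    IsMaxSpectral A C ↔ IsMaxSpectral (maxPow A k) D :=
  and_congr (iff_of_true h.1 h.2.1)
    (spectral_iff_of_root_pow_le hk (maxPow_ne_zero_iff_hasPath A k)
      (fun _ _ => classMaxRoot_pow hk) (fun _ _ => exists_edge_of_classMaxRoot_ne_zero) h)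

end Roots

end NonnegMatrix

theorem theorem4p4 (n : ℕ) (A : Matrix (Fin n) (Fin n) ℝ≥0) (k : ℕ) (hk : 1 ≤ k) :
    -- nonnegative linear algebra
    ((∀ C D : Finset (Fin n), NonnegMatrix.IsDerived A (A ^ k) C D →
        (NonnegMatrix.IsSpectral A C ↔ NonnegMatrix.IsSpectral (A ^ k) D)) ∧
      (∀ D : Finset (Fin n), NonnegMatrix.IsSpectral (A ^ k) D →
        ∃ C : Finset (Fin n), NonnegMatrix.IsSpectral A C ∧
          NonnegMatrix.IsDerived A (A ^ k) C D) ∧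
      (∀ C : Finset (Fin n), NonnegMatrix.IsClass A C →
        {D : Finset (Fin n) | NonnegMatrix.IsDerived A (A ^ k) C D}.ncard =
            Nat.gcd k (NonnegMatrix.classCyclicity A C) ∧
          (NonnegMatrix.classCyclicity A C ∣ k → ∀ D : Finset (Fin n),
            NonnegMatrix.IsDerived A (A ^ k) C D ↔ NonnegMatrix.IsCyclicClassOf A C D))) ∧
    -- max algebra
    ((∀ C D : Finset (Fin n), NonnegMatrix.IsDerived A (NonnegMatrix.maxPow A k) C D →
        (NonnegMatrix.IsMaxSpectral A C ↔
          NonnegMatrix.IsMaxSpectral (NonnegMatrix.maxPow A k) D)) ∧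
      (∀ D : Finset (Fin n), NonnegMatrix.IsMaxSpectral (NonnegMatrix.maxPow A k) D →
        ∃ C : Finset (Fin n), NonnegMatrix.IsMaxSpectral A C ∧
          NonnegMatrix.IsDerived A (NonnegMatrix.maxPow A k) C D) ∧
      (∀ C : Finset (Fin n), NonnegMatrix.IsClass A C →
        {D : Finset (Fin n) |
            NonnegMatrix.IsDerived A (NonnegMatrix.maxPow A k) C D}.ncard =
            Nat.gcd k (NonnegMatrix.classCyclicity A C) ∧
          (NonnegMatrix.classCyclicity A C ∣ k → ∀ D : Finset (Fin n),
            NonnegMatrix.IsDerived A (NonnegMatrix.maxPow A k) C D ↔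
              NonnegMatrix.IsCyclicClassOf A C D))) := by
  constructor
  · have hB := NonnegMatrix.pow_ne_zero_iff_hasPath A k
    refine ⟨fun C D => NonnegMatrix.isSpectral_iff hk, fun D hD => ?_, fun C hC =>
      ⟨NonnegMatrix.ncard_isDerived hk hB hC, fun hσ D =>
        NonnegMatrix.isDerived_iff_isCyclicClassOf hk hB hC hσ⟩⟩
    obtain ⟨C, hC⟩ := NonnegMatrix.exists_isDerived hB hD.1
    exact ⟨C, (NonnegMatrix.isSpectral_iff hk hC).2 hD, hC⟩
  · have hB := NonnegMatrix.maxPow_ne_zero_iff_hasPath A k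
    refine ⟨fun C D => NonnegMatrix.isMaxSpectral_iff hk, fun D hD => ?_, fun C hC =>
      ⟨NonnegMatrix.ncard_isDerived hk hB hC, fun hσ D =>
        NonnegMatrix.isDerived_iff_isCyclicClassOf hk hB hC hσ⟩⟩
    obtain ⟨C, hC⟩ := NonnegMatrix.exists_isDerived hB hD.1
    exact ⟨C, (NonnegMatrix.isMaxSpectral_iff hk hC).2 hD, hC⟩
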